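/- Let $k\ge 1$ and let $\Gamma^k=(V,L)$ be the Cayley tree of order $k$ (the infinite tree in which every vertex has exactly $k+1$ neighbours), with root $x^0\in V$, graph distance $d$, spheres $W_n=\{x: d(x,x^0)=n\}$ and balls $V_n=\{x:d(x,x^0)\le n\}$. Let $q\ge 1$, $\Phi=\{1,\dots,q\}$, $J\in\mathbb R$, $T>0$, $\beta=1/T$. For a family of vectors $\tilde h_x=(\tilde h_{1,x},\dots,\tilde h_{q,x})\in\mathbb R^q$, $x\in V$, and $n\ge 1$, let $\mu_n$ be the probability distribution on $\Phi^{V_n}$ given by $$\mu_n(\sigma_n)=Z_n^{-1}\exp\Big\{\beta J\sum_{\langle x,y\rangle\in L,\ x,y\in V_n}\delta_{\sigma_n(x)\sigma_n(y)}+\sum_{x\in W_n}\tilde h_{\sigma_n(x),x}\Big\},$$ where $Z_n$ is the normalizing constant. If these distributions are compatible, i.e. $\sum_{\omega\in\Phi^{W_{n+1}}}\mu_{n+1}(\sigma_n\vee\omega)=\mu_n(\sigma_n)$ for all $n\ge1$ and $\sigma_n\in\Phi^{V_n}$, then the unique probability measure $\mu$ on $\Phi^V$ with $\mu(\{\sigma|_{V_n}=\sigma_n\})=\mu_n(\sigma_n)$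 for all $n\ge1$ and $\sigma_n\in\Phi^{V_n}$ is called a splitting Gibbs measure of the Potts model. It is called translation-invariant if the vector $h_x=(\tilde h_{i,x}-\tilde h_{q,x})_{i=1}^{q-1}$ can be chosen not to depend on $x\in V$. Let $\mathcal G_{TI}$ be the set of all translation-invariant splitting Gibbs measures. Theorem. Every $\mu\in\mathcal G_{TI}$ is an extreme point of the convex hull of $\mathcal G_{TI}$. Equivalently, no $\mu\in\mathcal G_{TI}$ is a convex combination of (finitely many) measures in $\mathcal G_{TI}\setminus\{\mu\}$. -/

import Mathlib

open MeasureTheory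

namespace PottsCayley

/-- `G` is a Cayley tree of order `k`: a tree in which exactly `k + 1` edges originate from each
vertex. -/
structure IsCayleyTree {V : Type*} (G : SimpleGraph V) (k : ℕ) : Prop where
  isTree : G.IsTree
  ncard_neighborSet : ∀ x : V, (G.neighborSet x).ncard = k + 1

theorem IsCayleyTree.finite_ball {V : Type*} {G : SimpleGraph V} {k : ℕ} (hG : IsCayleyTree G k)
    (x₀ : V) (n : ℕ) : {x : V | G.dist x x₀ ≤ n}.Finite := by
  have hN : ∀ x : V, (G.neighborSet x).Finite := fun x =>
    Set.finite_of_ncard_ne_zero (by rw [hG.ncard_neighborSet x]; omega)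
  have hc : G.Connected := hG.isTree.connected
  induction n with
  | zero =>
    refine (Set.finite_singleton x₀).subset fun x hx => ?_
    have h0 : G.dist x x₀ = 0 := Nat.le_zero.mp hx
    exact hc.dist_eq_zero_iff.mp h0
  | succ n ih =>
    refine ((Set.finite_singleton x₀).union (ih.biUnion fun x _ => hN x)).subset fun y hy => ?_
    obtain ⟨p, hp⟩ := hc.exists_walk_length_eq_dist y x₀
    cases p with
    | nil => exact Or.inl rfl
    | @cons _ x _ h p' =>
      right
      have h1 : p'.length + 1 = G.dist y x₀ := by simpa using hp
      have h2 : G.dist x x₀ ≤ p'.length := SimpleGraph.dist_le p'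
      have h3 : G.dist y x₀ ≤ n + 1 := hy
      refine Set.mem_biUnion (x := x) (show G.dist x x₀ ≤ n by omega) ?_
      exact h.symm

section Model

variable {V : Type*} {G : SimpleGraph V} {k : ℕ}

/-- The ball `V_n` of all vertices at distance at most `n` from the root `x₀`. -/
noncomputable def ball (hG : IsCayleyTree G k) (x₀ : V) (n : ℕ) : Finset V :=
  (hG.finite_ball x₀ n).toFinset

theorem mem_ball (hG : IsCayleyTree G k) (x₀ : V) (n : ℕ) (x : V) :
    x ∈ ball hG x₀ n ↔ G.dist x x₀ ≤ n := by
  simp [ball]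

theorem ball_subset_succ (hG : IsCayleyTree G k) (x₀ : V) (n : ℕ) :
    ball hG x₀ n ⊆ ball hG x₀ (n + 1) := fun x hx =>
  (mem_ball hG x₀ (n + 1) x).mpr (Nat.le_succ_of_le ((mem_ball hG x₀ n x).mp hx))

/-- `δ_{σ(x) σ(y)}` for an (unordered) edge `⟨x, y⟩`. -/
noncomputable def edgeDelta {U : Type*} {q : ℕ} (σ : U → Fin q) (e : Sym2 U) : ℝ :=
  Sym2.lift ⟨fun x y => if σ x = σ y then (1 : ℝ) else 0, fun x y => by simp [eq_comm]⟩ e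

open Classical in
/-- The Potts Hamiltonian `H_n(σ_n) = -J ∑_{⟨x, y⟩} δ_{σ_n(x) σ_n(y)}`, the sum being over the edges
with both endpoints in `V_n`. -/
noncomputable def hamiltonian (hG : IsCayleyTree G k) (x₀ : V) (q : ℕ) (J : ℝ) (n : ℕ)
    (σ : ball hG x₀ n → Fin q) : ℝ :=
  -J * ∑ e ∈ (G.comap (Subtype.val : ball hG x₀ n → V)).edgeFinset, edgeDelta σ e

open Classical in
/-- `exp(-β H_n(σ_n) + ∑_{x ∈ W_n} h̃_{σ_n(x), x})` with `β = 1 / T`, where `W_n` is the sphere of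
radius `n` about the root; `h x i` stands for `h̃_{i, x}`. -/
noncomputable def weight (hG : IsCayleyTree G k) (x₀ : V) (q : ℕ) (J T : ℝ) (h : V → Fin q → ℝ)
    (n : ℕ) (σ : ball hG x₀ n → Fin q) : ℝ :=
  Real.exp (-(1 / T) * hamiltonian hG x₀ q J n σ +
    ∑ x ∈ Finset.univ.filter (fun x : ball hG x₀ n => G.dist x.1 x₀ = n), h x.1 (σ x))

open Classical in
/-- The finite-dimensional distribution `μ_n(σ_n) = Z_n⁻¹ exp(…)` in the volume `V_n`. -/
noncomputable def finiteDist (hG : IsCayleyTree G k) (x₀ : V) (q : ℕ) (J T : ℝ)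
    (h : V → Fin q → ℝ) (n : ℕ) (σ : ball hG x₀ n → Fin q) : ℝ :=
  weight hG x₀ q J T h n σ / ∑ τ : ball hG x₀ n → Fin q, weight hG x₀ q J T h n τ

open Classical in
/-- The distributions `μ_1, μ_2, …` are compatible: summing `μ_{n+1}` over all extensions of
`σ_n ∈ Φ^{V_n}` to `V_{n+1}` gives `μ_n(σ_n)`. -/
def IsCompatible (hG : IsCayleyTree G k) (x₀ : V) (q : ℕ) (J T : ℝ) (h : V → Fin q → ℝ) : Prop :=
  ∀ n : ℕ, 1 ≤ n → ∀ σ : ball hG x₀ n → Fin q,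
    (∑ τ : ball hG x₀ (n + 1) → Fin q
        with ∀ x : ball hG x₀ n, τ ⟨x, ball_subset_succ hG x₀ n x.2⟩ = σ x,
      finiteDist hG x₀ q J T h (n + 1) τ) = finiteDist hG x₀ q J T h n σ

/-- `μ` is the splitting Gibbs measure of the Potts model corresponding to the vector-valued
function `h`. -/
structure IsSplittingGibbsMeasure (hG : IsCayleyTree G k) (x₀ : V) (q : ℕ) (J T : ℝ)
    (h : V → Fin q → ℝ) (μ : Measure (V → Fin q)) : Prop where
  isProbabilityMeasure : IsProbabilityMeasure μ
  isCompatible : IsCompatible hG x₀ q J T h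
  cylinder : ∀ n : ℕ, 1 ≤ n → ∀ σ : ball hG x₀ n → Fin q,
    μ {ω | ∀ x : ball hG x₀ n, ω x = σ x} = ENNReal.ofReal (finiteDist hG x₀ q J T h n σ)

/-- The reduced field `h_{i, x} = h̃_{i, x} - h̃_{q, x}`; the spin value `q` is the last element
of `Fin q`. (The component at the last spin value is identically `0`.) -/
def reducedField {q : ℕ} [NeZero q] (h : V → Fin q → ℝ) (x : V) (i : Fin q) : ℝ :=
  h x i - h x ⟨q - 1, Nat.sub_one_lt (NeZero.ne q)⟩

/-- The set `𝒢_TI` of all translation-invariant splitting Gibbs measures: those whose reduced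
field does not depend on the vertex. -/
def translationInvariantSGM (hG : IsCayleyTree G k) (x₀ : V) (q : ℕ) [NeZero q] (J T : ℝ) :
    Set (Measure (V → Fin q)) :=
  {μ | ∃ h : V → Fin q → ℝ, IsSplittingGibbsMeasure hG x₀ q J T h μ ∧
    ∃ c : Fin q → ℝ, ∀ x : V, reducedField h x = c}

end Model

end PottsCayley

/-!
A translation-invariant splitting Gibbs measure is determined by its reduced field `c`, because the
part of the field common to all spin values cancels against the normalizing constant. Fix two
neighbours `a ≠ b` of the root, and let `σ_{ij}` be the configuration on the unit ball with spin `i`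
at `a`, spin `j` at `b`, and the last spin value elsewhere. Since `c` vanishes at the last spin
value, a measure `ν` with reduced field `c` gives the cylinder of `σ_{ij}` a mass which, after
division by the Boltzmann factor of `σ_{ij}` (common to all the measures considered), equals
`K exp (c i) exp (c j)` with `K > 0`: a positive semidefinite matrix of rank one (`rescaledMass_eq`).

Rank-one matrices span extreme rays of the positive semidefinite cone, and this is made explicit by
a functional: if `z` is the vector `exp ∘ c` of `μ`, then the sum over `i` of the quadratic form of
`ν` at `e_i - z_i e_q` is affine in `ν`. It equals `K' ∑ i, (exp (c' i) - exp (c i)) ^ 2` at the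
measure with reduced field `c'`, so it vanishes at `μ` and is positive at every other
translation-invariant measure. So `μ` is exposed by this functional
(`mem_extremePoints_convexHull_of_affine`, `notMem_convexHull_diff_of_affine`).
-/

namespace PottsCayley

/-! ### Points exposed by an affine functional -/

section Exposed

variable {E : Type*} [AddCommMonoid E] [Module NNReal E] {A S : Set E} {F : E → ℝ} {m : E}

theorem convex_setOf_nonneg_and_eq_of_eq_zero (hA : Convex NNReal A)
    (hF : ∀ x ∈ A, ∀ y ∈ A, ∀ a b : NNReal, F (a • x + b • y) = a * F x + b * F y) :
    Convex NNReal {x | x ∈ A ∧ 0 ≤ F x ∧ (F x = 0 → x = m)} := by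
  rintro x ⟨hxA, hx0, hx⟩ y ⟨hyA, hy0, hy⟩ a b ha hb hab
  refine ⟨hA hxA hyA ha hb hab, ?_, fun h0 => ?_⟩
  · rw [hF x hxA y hyA]
    positivity
  rw [hF x hxA y hyA] at h0
  have h1 : 0 ≤ (a : ℝ) * F x := by positivity
  have h2 : 0 ≤ (b : ℝ) * F y := by positivity
  rcases mul_eq_zero.mp (show (a : ℝ) * F x = 0 by linarith) with ha0 | hFx
  · have ha0 : a = 0 := by exact_mod_cast ha0
    subst ha0
    have hb1 : b = 1 := by simpa using hab
    subst hb1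
    have hFy : F y = 0 := by simpa using h0
    simp [hy hFy]
  rcases mul_eq_zero.mp (show (b : ℝ) * F y = 0 by linarith) with hb0 | hFy
  · have hb0 : b = 0 := by exact_mod_cast hb0
    subst hb0
    have ha1 : a = 1 := by simpa using hab
    subst ha1
    simp [hx hFx]
  · rw [hx hFx, hy hFy, ← add_smul, hab, one_smul]

/-- A point where a nonnegative functional, affine on a convex set containing `S`, attains its only
zero in `S` is an extreme point of the convex hull of `S`. -/
theorem mem_extremePoints_convexHull_of_affine (hA : Convex NNReal A)
    (hF : ∀ x ∈ A, ∀ y ∈ A, ∀ a b : NNReal, F (a • x + b • y) = a * F x + b * F y)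
    (hSA : S ⊆ A) (hS0 : ∀ x ∈ S, 0 ≤ F x) (hS : ∀ x ∈ S, F x = 0 → x = m)
    (hm : m ∈ S) (hm0 : F m = 0) :
    m ∈ (convexHull NNReal S).extremePoints NNReal := by
  have hull : convexHull NNReal S ⊆ {x | x ∈ A ∧ 0 ≤ F x ∧ (F x = 0 → x = m)} :=
    convexHull_min (fun x hx => ⟨hSA hx, hS0 x hx, hS x hx⟩)
      (convex_setOf_nonneg_and_eq_of_eq_zero hA hF)
  refine mem_extremePoints_iff_left.mpr ⟨subset_convexHull _ _ hm, fun x hx y hy hxy => ?_⟩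
  obtain ⟨hxA, hx0, hx⟩ := hull hx
  obtain ⟨hyA, hy0, -⟩ := hull hy
  obtain ⟨a, b, ha, hb, -, rfl⟩ := hxy
  rw [hF x hxA y hyA] at hm0
  have h2 : 0 ≤ (b : ℝ) * F y := by positivity
  have ha' : (0 : ℝ) < a := by exact_mod_cast ha
  exact hx (by nlinarith)

theorem notMem_convexHull_diff_of_affine (hA : Convex NNReal A)
    (hF : ∀ x ∈ A, ∀ y ∈ A, ∀ a b : NNReal, F (a • x + b • y) = a * F x + b * F y)
    (hSA : S ⊆ A) (hS0 : ∀ x ∈ S, 0 ≤ F x) (hS : ∀ x ∈ S, F x = 0 → x = m) (hm0 : F m = 0) :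
    m ∉ convexHull NNReal (S \ {m}) := by
  intro h
  have hconv : Convex NNReal {x | x ∈ A ∧ 0 < F x} := by
    rintro x ⟨hxA, hx⟩ y ⟨hyA, hy⟩ a b ha hb hab
    refine ⟨hA hxA hyA ha hb hab, ?_⟩
    rw [hF x hxA y hyA]
    rcases eq_or_lt_of_le ha with rfl | ha
    · have hb1 : b = 1 := by simpa using hab
      simpa [hb1] using hy
    · have ha' : (0 : ℝ) < a := by exact_mod_cast ha
      positivity
  have hull : convexHull NNReal (S \ {m}) ⊆ {x | x ∈ A ∧ 0 < F x} :=
    convexHull_min (fun x hx => ⟨hSA hx.1, (hS0 x hx.1).lt_of_ne fun h0 =>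
      hx.2 (hS x hx.1 h0.symm)⟩) hconv
  exact (hull h).2.ne' hm0

end Exposed

/-! ### Translation-invariant measures and their reduced fields -/

section Field

variable {V : Type*} {G : SimpleGraph V} {k : ℕ}

/-- A spin-independent summand of the field cancels against the normalizing constant. -/
theorem finiteDist_eq_of_reducedField_eq (hG : IsCayleyTree G k) (x₀ : V) {q : ℕ} [NeZero q]
    (J T : ℝ) {h : V → Fin q → ℝ} {c : Fin q → ℝ} (hc : ∀ x, reducedField h x = c) (n : ℕ)
    (σ : ball hG x₀ n → Fin q) :
    finiteDist hG x₀ q J T h n σ = finiteDist hG x₀ q J T (fun _ => c) n σ := by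
  classical
  have hh : ∀ x i, h x i = c i + h x ⟨q - 1, Nat.sub_one_lt (NeZero.ne q)⟩ := fun x i => by
    rw [← hc x]; simp [reducedField]
  obtain ⟨D, hD⟩ : ∃ D : ℝ, ∀ τ, weight hG x₀ q J T h n τ =
      weight hG x₀ q J T (fun _ => c) n τ * Real.exp D := by
    refine ⟨∑ x ∈ Finset.univ.filter (fun x : ball hG x₀ n => G.dist x.1 x₀ = n),
      h x.1 ⟨q - 1, Nat.sub_one_lt (NeZero.ne q)⟩, fun τ => ?_⟩
    rw [weight, weight, ← Real.exp_add, add_assoc, ← Finset.sum_add_distrib]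
    congr 2
    exact Finset.sum_congr rfl fun x _ => hh _ _
  simp only [finiteDist, hD, ← Finset.sum_mul]
  rw [mul_div_mul_right _ _ (Real.exp_pos D).ne']

theorem finiteDist_nonneg (hG : IsCayleyTree G k) (x₀ : V) (q : ℕ) (J T : ℝ) (h : V → Fin q → ℝ)
    (n : ℕ) (σ : ball hG x₀ n → Fin q) : 0 ≤ finiteDist hG x₀ q J T h n σ :=
  div_nonneg (Real.exp_pos _).le (Finset.sum_nonneg fun _ _ => (Real.exp_pos _).le)

theorem exists_subset_ball (hG : IsCayleyTree G k) (x₀ : V) (I : Finset V) :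
    ∃ n, 1 ≤ n ∧ I ⊆ ball hG x₀ n :=
  ⟨I.sup (fun x => G.dist x x₀) + 1, by omega, fun x hx => (mem_ball hG x₀ _ x).mpr
    (Nat.le_succ_of_le (Finset.le_sup (f := fun x => G.dist x x₀) hx))⟩

theorem measure_eq_of_ball_cylinder_eq (hG : IsCayleyTree G k) (x₀ : V) {q : ℕ}
    {μ ν : Measure (V → Fin q)} [IsFiniteMeasure μ]
    (h : ∀ n, 1 ≤ n → ∀ σ : ball hG x₀ n → Fin q,
      μ {ω | ∀ x : ball hG x₀ n, ω x = σ x} = ν {ω | ∀ x : ball hG x₀ n, ω x = σ x}) :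
    μ = ν := by
  have hball : ∀ n, 1 ≤ n → ν.map (ball hG x₀ n).restrict = μ.map (ball hG x₀ n).restrict := by
    intro n hn
    refine Measure.ext_of_singleton fun σ => ?_
    have hpre : (ball hG x₀ n).restrict (π := fun _ => Fin q) ⁻¹' {σ} =
        {ω : V → Fin q | ∀ x : ball hG x₀ n, ω x = σ x} := by
      ext ω
      simp [funext_iff]
    rw [Measure.map_apply (Finset.measurable_restrict _) (measurableSet_singleton σ),
      Measure.map_apply (Finset.measurable_restrict _) (measurableSet_singleton σ), hpre, h n hn]
  refine IsProjectiveLimit.unique (P := fun I => μ.map I.restrict) (fun I => rfl) fun I => ?_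
  obtain ⟨n, hn, hI⟩ := exists_subset_ball hG x₀ I
  have hcomp := Finset.restrict₂_comp_restrict (π := fun _ : V => Fin q) hI
  change ν.map I.restrict = μ.map I.restrict
  rw [← hcomp, ← Measure.map_map (Finset.measurable_restrict₂ hI) (Finset.measurable_restrict _),
    ← Measure.map_map (Finset.measurable_restrict₂ hI) (Finset.measurable_restrict _), hball n hn]

/-! ### The rank-one matrix of a translation-invariant measure -/

open Classical in
/-- The configuration on the unit ball with spin `i` at `a`, spin `j` at `b` and the last spin value
at all other vertices. -/
noncomputable def twoSpinConfig (hG : IsCayleyTree G k) (x₀ : V) {q : ℕ} [NeZero q] (a b : V)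
    (i j : Fin q) (x : ball hG x₀ 1) : Fin q :=
  if x.1 = a then i else if x.1 = b then j else ⟨q - 1, Nat.sub_one_lt (NeZero.ne q)⟩

/-- The mass of the cylinder over `twoSpinConfig`, divided by the Boltzmann factor `exp (-β H_1)`
of that configuration. -/
noncomputable def rescaledMass (hG : IsCayleyTree G k) (x₀ : V) {q : ℕ} [NeZero q] (J T : ℝ)
    (a b : V) (i j : Fin q) (ν : Measure (V → Fin q)) : ℝ :=
  ν.real {ω | ∀ x : ball hG x₀ 1, ω x = twoSpinConfig hG x₀ a b i j x} /
    Real.exp (-(1 / T) * hamiltonian hG x₀ q J 1 (twoSpinConfig hG x₀ a b i j))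

theorem rescaledMass_add (hG : IsCayleyTree G k) (x₀ : V) {q : ℕ} [NeZero q] (J T : ℝ)
    (a b : V) (i j : Fin q) (ν₁ ν₂ : Measure (V → Fin q)) [IsFiniteMeasure ν₁] [IsFiniteMeasure ν₂]
    (s t : NNReal) :
    rescaledMass hG x₀ J T a b i j (s • ν₁ + t • ν₂) =
      s * rescaledMass hG x₀ J T a b i j ν₁ + t * rescaledMass hG x₀ J T a b i j ν₂ := by
  rw [rescaledMass, measureReal_add_apply, measureReal_nnreal_smul_apply,
    measureReal_nnreal_smul_apply, rescaledMass, rescaledMass]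
  ring

theorem rescaledMass_eq (hG : IsCayleyTree G k) {x₀ : V} {q : ℕ} [NeZero q] {J T : ℝ}
    {a b : V} (hab : a ≠ b) (ha : G.Adj x₀ a) (hb : G.Adj x₀ b) {h : V → Fin q → ℝ}
    {c : Fin q → ℝ} (hc : ∀ x, reducedField h x = c) {ν : Measure (V → Fin q)}
    (hν : IsSplittingGibbsMeasure hG x₀ q J T h ν) :
    ∃ K : ℝ, 0 < K ∧ ∀ i j,
      rescaledMass hG x₀ J T a b i j ν = K * (Real.exp (c i) * Real.exp (c j)) := by
  classical
  have hq : c ⟨q - 1, Nat.sub_one_lt (NeZero.ne q)⟩ = 0 := by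
    rw [← hc x₀]; simp [reducedField]
  have hda : G.dist a x₀ = 1 := SimpleGraph.dist_eq_one_iff_adj.mpr ha.symm
  have hdb : G.dist b x₀ = 1 := SimpleGraph.dist_eq_one_iff_adj.mpr hb.symm
  refine ⟨(∑ τ, weight hG x₀ q J T (fun _ => c) 1 τ)⁻¹, inv_pos.mpr
    (Finset.sum_pos (fun _ _ => Real.exp_pos _) Finset.univ_nonempty), fun i j => ?_⟩
  have hsum : ∑ x ∈ Finset.univ.filter (fun x : ball hG x₀ 1 => G.dist x.1 x₀ = 1),
      c (twoSpinConfig hG x₀ a b i j x) = c i + c j := by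
    let a' : ball hG x₀ 1 := ⟨a, (mem_ball hG x₀ 1 a).mpr hda.le⟩
    let b' : ball hG x₀ 1 := ⟨b, (mem_ball hG x₀ 1 b).mpr hdb.le⟩
    have hab' : a' ≠ b' := fun h => hab (congrArg Subtype.val h)
    have hsub : ({a', b'} : Finset (ball hG x₀ 1)) ⊆
        Finset.univ.filter (fun x : ball hG x₀ 1 => G.dist x.1 x₀ = 1) := by
      intro x hx
      rcases Finset.mem_insert.mp hx with rfl | hx
      · simpa using hda
      · rw [Finset.mem_singleton] at hx
        subst hx
        simpa using hdb
    rw [← Finset.sum_subset hsub, Finset.sum_pair hab']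
    · simp [twoSpinConfig, a', b', hab.symm]
    · intro x _ hx
      have hxa : x.1 ≠ a := fun h => hx (by simp [show x = a' from Subtype.ext h])
      have hxb : x.1 ≠ b := fun h => hx (by simp [show x = b' from Subtype.ext h])
      rw [twoSpinConfig, if_neg hxa, if_neg hxb, hq]
  rw [rescaledMass, measureReal_def, hν.cylinder 1 le_rfl,
    ENNReal.toReal_ofReal (finiteDist_nonneg _ _ _ _ _ _ _ _),
    finiteDist_eq_of_reducedField_eq hG x₀ J T hc, finiteDist, weight, hsum, Real.exp_add,
    Real.exp_add]
  field_simp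

/-- The quadratic form of the matrix `rescaledMass` at the vectors `e_i - exp (c i) e_q`, summed
over `i`, where `q` stands for the last spin value. -/
noncomputable def exposingFunctional (hG : IsCayleyTree G k) (x₀ : V) {q : ℕ} [NeZero q] (J T : ℝ)
    (a b : V) (c : Fin q → ℝ) (ν : Measure (V → Fin q)) : ℝ :=
  ∑ i, (rescaledMass hG x₀ J T a b i i ν
    - 2 * Real.exp (c i) *
      rescaledMass hG x₀ J T a b i ⟨q - 1, Nat.sub_one_lt (NeZero.ne q)⟩ ν
    + Real.exp (c i) ^ 2 *
      rescaledMass hG x₀ J T a b ⟨q - 1, Nat.sub_one_lt (NeZero.ne q)⟩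
        ⟨q - 1, Nat.sub_one_lt (NeZero.ne q)⟩ ν)

theorem exposingFunctional_add (hG : IsCayleyTree G k) (x₀ : V) {q : ℕ} [NeZero q] (J T : ℝ)
    (a b : V) (c : Fin q → ℝ) (ν₁ ν₂ : Measure (V → Fin q)) [IsFiniteMeasure ν₁]
    [IsFiniteMeasure ν₂] (s t : NNReal) :
    exposingFunctional hG x₀ J T a b c (s • ν₁ + t • ν₂) =
      s * exposingFunctional hG x₀ J T a b c ν₁ + t * exposingFunctional hG x₀ J T a b c ν₂ := by
  simp only [exposingFunctional, rescaledMass_add, Finset.mul_sum]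
  rw [← Finset.sum_add_distrib]
  exact Finset.sum_congr rfl fun i _ => by ring

theorem exposingFunctional_eq (hG : IsCayleyTree G k) {x₀ : V} {q : ℕ} [NeZero q] {J T : ℝ}
    {a b : V} (hab : a ≠ b) (ha : G.Adj x₀ a) (hb : G.Adj x₀ b) (c : Fin q → ℝ)
    {h : V → Fin q → ℝ} {c' : Fin q → ℝ} (hc' : ∀ x, reducedField h x = c')
    {ν : Measure (V → Fin q)} (hν : IsSplittingGibbsMeasure hG x₀ q J T h ν) :
    ∃ K : ℝ, 0 < K ∧ exposingFunctional hG x₀ J T a b c ν =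
      K * ∑ i, (Real.exp (c' i) - Real.exp (c i)) ^ 2 := by
  obtain ⟨K, hK, hmass⟩ := rescaledMass_eq hG hab ha hb hc' hν
  have hq : c' ⟨q - 1, Nat.sub_one_lt (NeZero.ne q)⟩ = 0 := by
    rw [← hc' x₀]; simp [reducedField]
  refine ⟨K, hK, ?_⟩
  simp only [exposingFunctional, hmass, hq, Real.exp_zero, Finset.mul_sum]
  exact Finset.sum_congr rfl fun i _ => by ring

end Field

end PottsCayley

open PottsCayley in
theorem theorem2 {V : Type*} {G : SimpleGraph V} {k : ℕ} (hk : 1 ≤ k)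
    (hG : PottsCayley.IsCayleyTree G k) (x₀ : V) (q : ℕ) [NeZero q] (J T : ℝ) (hT : 0 < T)
    (μ : MeasureTheory.Measure (V → Fin q))
    (hμ : μ ∈ PottsCayley.translationInvariantSGM hG x₀ q J T) :
    μ ∈ (convexHull NNReal (PottsCayley.translationInvariantSGM hG x₀ q J T)).extremePoints
        NNReal ∧
      μ ∉ convexHull NNReal (PottsCayley.translationInvariantSGM hG x₀ q J T \ {μ}) := by
  obtain ⟨h, hhμ, c, hc⟩ := id hμ
  obtain ⟨a, b, ha, hb, hab⟩ : ∃ a b, a ∈ G.neighborSet x₀ ∧ b ∈ G.neighborSet x₀ ∧ a ≠ b := by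
    have hcard := hG.ncard_neighborSet x₀
    exact (Set.one_lt_ncard_iff (Set.finite_of_ncard_ne_zero (by omega))).mp (by omega)
  have hA : Convex NNReal {ν : Measure (V → Fin q) | IsFiniteMeasure ν} := by
    intro ν₁ (h₁ : IsFiniteMeasure ν₁) ν₂ (h₂ : IsFiniteMeasure ν₂) s t _ _ _
    exact inferInstanceAs (IsFiniteMeasure (s • ν₁ + t • ν₂))
  have hF : ∀ ν₁ ∈ {ν : Measure (V → Fin q) | IsFiniteMeasure ν},
      ∀ ν₂ ∈ {ν : Measure (V → Fin q) | IsFiniteMeasure ν}, ∀ s t : NNReal,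
      exposingFunctional hG x₀ J T a b c (s • ν₁ + t • ν₂) =
        s * exposingFunctional hG x₀ J T a b c ν₁ +
          t * exposingFunctional hG x₀ J T a b c ν₂ := by
    intro ν₁ (h₁ : IsFiniteMeasure ν₁) ν₂ (h₂ : IsFiniteMeasure ν₂) s t
    exact exposingFunctional_add hG x₀ J T a b c ν₁ ν₂ s t
  have hSA : translationInvariantSGM hG x₀ q J T ⊆
      {ν : Measure (V → Fin q) | IsFiniteMeasure ν} := by
    rintro ν ⟨h', hν, -⟩
    have := hν.isProbabilityMeasure
    exact inferInstanceAs (IsFiniteMeasure ν)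
  have hS0 : ∀ ν ∈ translationInvariantSGM hG x₀ q J T,
      0 ≤ exposingFunctional hG x₀ J T a b c ν := by
    rintro ν ⟨h', hν, c', hc'⟩
    obtain ⟨K, hK, hval⟩ := exposingFunctional_eq hG hab ha hb c hc' hν
    rw [hval]
    positivity
  have hS : ∀ ν ∈ translationInvariantSGM hG x₀ q J T,
      exposingFunctional hG x₀ J T a b c ν = 0 → ν = μ := by
    rintro ν ⟨h', hν, c', hc'⟩ h0
    obtain ⟨K, hK, hval⟩ := exposingFunctional_eq hG hab ha hb c hc' hν
    rw [hval, mul_eq_zero, or_iff_right hK.ne',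
      Finset.sum_eq_zero_iff_of_nonneg fun i _ => sq_nonneg _] at h0
    have hcc : c' = c := funext fun i =>
      Real.exp_injective (sub_eq_zero.mp (pow_eq_zero_iff two_ne_zero |>.mp
        (h0 i (Finset.mem_univ i))))
    subst hcc
    have := hν.isProbabilityMeasure
    refine measure_eq_of_ball_cylinder_eq hG x₀ fun n hn σ => ?_
    rw [hν.cylinder n hn, hhμ.cylinder n hn, finiteDist_eq_of_reducedField_eq hG x₀ J T hc',
      finiteDist_eq_of_reducedField_eq hG x₀ J T hc]
  have hm0 : exposingFunctional hG x₀ J T a b c μ = 0 := by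
    obtain ⟨K, hK, hval⟩ := exposingFunctional_eq hG hab ha hb c hc hhμ
    simp [hval]
  exact ⟨mem_extremePoints_convexHull_of_affine hA hF hSA hS0 hS hμ hm0,
    notMem_convexHull_diff_of_affine hA hF hSA hS0 hS hm0⟩
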